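/- Let $G=(V,E)$ be a finite connected (simple, undirected) graph with $r=|V|\ge 2$ vertices, let $\Delta_{r-1}=\{x\in\mathbf R_{\ge0}^V:\sum_{i\in V}x_i=1\}$, and let $\mathcal P(\Delta_{r-1})$ be the set of probability measures on $\Delta_{r-1}$ with the topology of weak convergence. For $\alpha>0$ consider the operator $$L_\alpha f=\frac12\sum_{i,j\in V}\sigma_{ij}(x)\frac{\partial^2 f}{\partial x_i\partial x_j} +\frac{\alpha}{2}\sum_{i\in V}(1-r x_i)\frac{\partial f}{\partial x_i},\qquad f\in C^2(\Delta_{r-1}),$$ where $\sigma_{ii}(x)=x_i\sum_{j\sim i}x_j$, $\sigma_{ij}(x)=-x_ix_j$ if $i\sim j$, and $\sigma_{ij}(x)=0$ otherwise. This is the generator of the diffusion $dx_i=\sum_{j\sim i}\sqrt{x_ix_j}\,dB_{ij}+\frac{\alpha}{2}(1-rx_i)\,dt$, $i\in V$, where the $B_{ij}=-B_{ji}$ are independent standard Brownian motions indexed by the edges. For each $\alpha>0$ let $\{\tilde T_t\}_{t\ge0}=\{\tilde T^{(\alpha)}_t\}_{t\ge 0}$ be a strongly continuous semigroup of linear operators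 on $C(\Delta_{r-1})$ with $\tilde T_t1=1$ and $\tilde T_tf\ge0$ for $f\ge0$, associated with this diffusion in the sense that $\tilde T_tf-f=\int_0^t\tilde T_sL_\alpha f\,ds$ for all $f\in C^2(\Delta_{r-1})$ and $t\ge0$. Let $\{\tilde T_t^*\}$ be the adjoint semigroup on $\mathcal P(\Delta_{r-1})$, determined by $\langle \tilde T_t^*\mu,f\rangle=\langle\mu,\tilde T_tf\rangle$; a stationary state is a measure $\nu\in\mathcal P(\Delta_{r-1})$ with $\tilde T_t^*\nu=\nu$ for all $t\ge0$. Then for every $\alpha>0$ a stationary state $\nu_\alpha$ of $\{\tilde T_t^*\}$ exists, and, for every choice of a stationary state $\nu_\alpha$ for each $\alpha>0$, $$\lim_{\alpha\to\infty}\nu_\alpha=\delta_{(1/r,\ldots,1/r)}$$ in the sense of weak convergence. -/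

import Mathlib

open MeasureTheory Filter Topology
open scoped NNReal

noncomputable section

namespace GraphDiffusion

/-- A strongly continuous Markov semigroup on `C(X)`, for a compact space `X`. -/
structure IsMarkovSemigroup {X : Type*} [TopologicalSpace X] [CompactSpace X]
    (T : ℝ≥0 → C(X, ℝ) →L[ℝ] C(X, ℝ)) : Prop where
  zero : T 0 = ContinuousLinearMap.id ℝ C(X, ℝ)
  add : ∀ s t : ℝ≥0, T (s + t) = (T s).comp (T t)
  strongly_continuous : ∀ f : C(X, ℝ), Continuous fun t : ℝ≥0 => T t f
  one : ∀ t : ℝ≥0, T t 1 = 1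
  nonneg : ∀ (t : ℝ≥0) (f : C(X, ℝ)), 0 ≤ f → 0 ≤ T t f

/-- `μ'` is the image of `μ` under the adjoint of `S : C(X) → C(X)`, that is
`⟨μ', f⟩ = ⟨μ, S f⟩` for all continuous `f`. -/
def IsAdjointImage {X : Type*} [TopologicalSpace X] [CompactSpace X] [MeasurableSpace X]
    (S : C(X, ℝ) →L[ℝ] C(X, ℝ)) (μ μ' : ProbabilityMeasure X) : Prop :=
  ∀ f : C(X, ℝ), ∫ x, f x ∂(μ' : Measure X) = ∫ x, S f x ∂(μ : Measure X)

/-- A stationary state: a common fixed point of the adjoint semigroup on probability measures. -/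
def IsStationaryState {X : Type*} [TopologicalSpace X] [CompactSpace X] [MeasurableSpace X]
    (T : ℝ≥0 → C(X, ℝ) →L[ℝ] C(X, ℝ)) (ν : ProbabilityMeasure X) : Prop :=
  ∀ t : ℝ≥0, IsAdjointImage (T t) ν ν

variable {V : Type*} [Fintype V] [DecidableEq V]

/-- The partial derivative `∂f/∂x_i`. -/
def partialDeriv (i : V) (f : (V → ℝ) → ℝ) (x : V → ℝ) : ℝ :=
  fderiv ℝ f x (Pi.single i 1)

/-- The diffusion matrix: `σ_ii = x_i ∑_{j ∼ i} x_j`, `σ_ij = -x_i x_j` if `i ∼ j`, and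
`σ_ij = 0` otherwise. -/
def diffusionCoeff (G : SimpleGraph V) [DecidableRel G.Adj] (x : V → ℝ) (i j : V) : ℝ :=
  if i = j then x i * ∑ k ∈ G.neighborFinset i, x k
  else if G.Adj i j then -(x i * x j) else 0

/-- The operator `½ ∑_{i,j} σ_ij ∂²/∂x_i∂x_j + (α/2) ∑_i (1 - r x_i) ∂/∂x_i`, `r = |V|`, of the
diffusion `dx_i = ∑_{j ∼ i} √(x_i x_j) dB_ij + (α/2) (1 - r x_i) dt`. -/
def driftOperator (G : SimpleGraph V) [DecidableRel G.Adj] (α : ℝ) (f : (V → ℝ) → ℝ)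
    (x : V → ℝ) : ℝ :=
  (1 / 2) * ∑ i, ∑ j, diffusionCoeff G x i j * partialDeriv i (partialDeriv j f) x
    + (α / 2) * ∑ i, (1 - (Fintype.card V : ℝ) * x i) * partialDeriv i f x

theorem contDiff_partialDeriv {f : (V → ℝ) → ℝ} {n : ℕ} (hf : ContDiff ℝ (n + 1 : ℕ) f) (i : V) :
    ContDiff ℝ n (partialDeriv i f) :=
  (hf.fderiv_right (m := n) (by norm_cast)).clm_apply contDiff_const

theorem continuous_driftOperator (G : SimpleGraph V) [DecidableRel G.Adj] (α : ℝ)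
    {f : (V → ℝ) → ℝ} (hf : ContDiff ℝ 2 f) : Continuous (driftOperator G α f) := by
  have h1 : ∀ i, ContDiff ℝ (1 : ℕ) (partialDeriv i f) :=
    contDiff_partialDeriv (n := 1) (by exact_mod_cast hf)
  have h2 : ∀ i j, Continuous (partialDeriv i (partialDeriv j f)) := fun i j =>
    (contDiff_partialDeriv (n := 0) (h1 j) i).continuous
  have h3 : ∀ i, Continuous (partialDeriv i f) := fun i => (h1 i).continuous
  have h4 : ∀ i j, Continuous fun x : V → ℝ => diffusionCoeff G x i j := by
    intro i j
    unfold diffusionCoeff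
    split_ifs <;> fun_prop
  unfold driftOperator
  fun_prop

/-- The restriction of a continuous function on `ℝ^V` to the simplex. -/
def onSimplex (f : (V → ℝ) → ℝ) (hf : Continuous f) : C(stdSimplex ℝ V, ℝ) :=
  ⟨fun x => f x, hf.comp continuous_subtype_val⟩

/-- `T` is a Markov semigroup on `C(Δ)` associated with the diffusion with linear drift:
`T_t f - f = ∫₀ᵗ T_s (L f) ds` for every `f` of class `C²`. -/
structure IsDiffusionSemigroup (G : SimpleGraph V) [DecidableRel G.Adj] (α : ℝ)
    (T : ℝ≥0 → C(stdSimplex ℝ V, ℝ) →L[ℝ] C(stdSimplex ℝ V, ℝ)) : Prop where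
  markov : IsMarkovSemigroup T
  generator : ∀ (f : (V → ℝ) → ℝ) (hf : ContDiff ℝ 2 f) (t : ℝ≥0),
    T t (onSimplex f hf.continuous) - onSimplex f hf.continuous =
      ∫ s in (0 : ℝ)..t,
        T s.toNNReal (onSimplex (driftOperator G α f) (continuous_driftOperator G α hf))

end GraphDiffusion

end

/-! Existence is a compactness argument: time averages of the semigroup started at a point have a
weak limit point, which is invariant (`IsMarkovSemigroup.exists_isStationaryState`). Concentration
uses the squared distance `u` to the barycenter as a Lyapunov function. On the simplex `L_α u = ∑
x_i ∑_{k∼i} x_k - α r u ≤ 1 - α r u`. A stationary state integrates `L_α u` to zero, so the mean of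
`u` is at most `1/(α r)`, which tends to `0`. Since `u` vanishes only at the barycenter, all mass
collapses there (`tendsto_diracProba_of_tendsto_integral`). -/

namespace GraphDiffusion

/-! ### Markov semigroups and weak convergence on a compact space. -/

section General

variable {X : Type*} [TopologicalSpace X] [CompactSpace X]

/-- The **Riesz representation theorem** for normalized positive functionals on `C(X)`. -/
theorem exists_probabilityMeasure_integral_eq [T2Space X] [MeasurableSpace X] [BorelSpace X]
    (Λ : C(X, ℝ) →ₗ[ℝ] ℝ) (hpos : ∀ f, 0 ≤ f → 0 ≤ Λ f) (hone : Λ 1 = 1) :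
    ∃ μ : ProbabilityMeasure X, ∀ f : C(X, ℝ), ∫ x, f x ∂(μ : Measure X) = Λ f := by
  let Φ : CompactlySupportedContinuousMap X ℝ →ₚ[ℝ] ℝ := PositiveLinearMap.mk₀
    { toFun := fun f => Λ f.toContinuousMap
      map_add' := fun f g => Λ.map_add f.toContinuousMap g.toContinuousMap
      map_smul' := fun c f => Λ.map_smul c f.toContinuousMap }
    (fun f hf => hpos f.toContinuousMap hf)
  have h (f : C(X, ℝ)) : ∫ x, f x ∂(RealRMK.rieszMeasure Φ) = Λ f :=
    RealRMK.integral_rieszMeasure Φ (CompactlySupportedContinuousMap.continuousMapEquiv f)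
  refine ⟨⟨RealRMK.rieszMeasure Φ, ⟨?_⟩⟩, h⟩
  have h1 := h 1
  simp only [ContinuousMap.one_apply, integral_const, smul_eq_mul, mul_one, hone] at h1
  exact (ENNReal.toReal_eq_one_iff _).1 h1

theorem integrable_continuousMap [MeasurableSpace X] [BorelSpace X] (f : C(X, ℝ))
    (μ : Measure X) [IsFiniteMeasure μ] : Integrable f μ :=
  f.continuous.integrable_of_hasCompactSupport (HasCompactSupport.of_compactSpace f)

/-- Integration against a probability measure as a continuous linear functional on `C(X)`. -/
noncomputable def integralCLM [MeasurableSpace X] [BorelSpace X] (μ : ProbabilityMeasure X) :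
    C(X, ℝ) →L[ℝ] ℝ :=
  LinearMap.mkContinuous
    { toFun := fun f => ∫ x, f x ∂(μ : Measure X)
      map_add' := fun f g =>
        integral_add (integrable_continuousMap f _) (integrable_continuousMap g _)
      map_smul' := fun c f => integral_const_mul c _ } 1 fun f => by
    simpa using norm_integral_le_of_norm_le_const (μ := (μ : Measure X))
      (ae_of_all _ fun x => f.norm_coe_le_norm x)

@[simp]
theorem integralCLM_apply [MeasurableSpace X] [BorelSpace X] (μ : ProbabilityMeasure X)
    (f : C(X, ℝ)) : integralCLM μ f = ∫ x, f x ∂(μ : Measure X) := rfl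

variable {T : ℝ≥0 → C(X, ℝ) →L[ℝ] C(X, ℝ)}

theorem IsMarkovSemigroup.continuous_toNNReal (hT : IsMarkovSemigroup T) (f : C(X, ℝ)) :
    Continuous fun s : ℝ => T s.toNNReal f :=
  (hT.strongly_continuous f).comp continuous_real_toNNReal

theorem IsMarkovSemigroup.continuous_eval (hT : IsMarkovSemigroup T) (f : C(X, ℝ)) (x : X) :
    Continuous fun s : ℝ => T s.toNNReal f x :=
  (continuous_eval_const x).comp (hT.continuous_toNNReal f)

/-- Positivity is applied to `‖f‖ • 1 ± f`, and `T t` fixes constants. -/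
theorem IsMarkovSemigroup.abs_apply_le (hT : IsMarkovSemigroup T) (t : ℝ≥0) (f : C(X, ℝ))
    (x : X) : |T t f x| ≤ ‖f‖ := by
  have h1 := hT.nonneg t (‖f‖ • 1 - f) fun y => by
    simpa using (le_abs_self _).trans (f.norm_coe_le_norm y)
  have h2 := hT.nonneg t (‖f‖ • 1 + f) fun y => by
    have := (neg_abs_le _).trans' (neg_le_neg (f.norm_coe_le_norm y))
    simpa using by linarith
  rw [map_sub, map_smul, hT.one] at h1
  rw [map_add, map_smul, hT.one] at h2
  have h3 : 0 ≤ ‖f‖ * 1 - T t f x := h1 x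
  have h4 : 0 ≤ ‖f‖ * 1 + T t f x := h2 x
  exact abs_le.2 ⟨by linarith, by linarith⟩

/-- The time average `N⁻¹ ∫₀ᴺ T_s f (x) ds` as a linear functional of `f`. -/
noncomputable def timeAverage (hT : IsMarkovSemigroup T) (x : X) (N : ℝ) : C(X, ℝ) →ₗ[ℝ] ℝ where
  toFun f := N⁻¹ * ∫ s in (0 : ℝ)..N, T s.toNNReal f x
  map_add' f g := by
    simp only [map_add, ContinuousMap.add_apply]
    rw [intervalIntegral.integral_add ((hT.continuous_eval f x).intervalIntegrable _ _)
      ((hT.continuous_eval g x).intervalIntegrable _ _), mul_add]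
  map_smul' c f := by
    simp only [map_smul, ContinuousMap.smul_apply, smul_eq_mul,
      intervalIntegral.integral_const_mul, RingHom.id_apply]
    ring

/-- Applying `T t` shifts the averaging window from `[0, N]` to `[t, N + t]`. The two integrals
differ by those over `[N, N + t]` and `[0, t]`, each at most `t * ‖f‖` in absolute value. -/
theorem abs_timeAverage_sub_le (hT : IsMarkovSemigroup T) (x : X) {N : ℝ} (hN : 0 < N)
    (t : ℝ≥0) (f : C(X, ℝ)) :
    |timeAverage hT x N (T t f) - timeAverage hT x N f| ≤ 2 * t * ‖f‖ * N⁻¹ := by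
  set g : ℝ → ℝ := fun s => T s.toNNReal f x
  have hg : Continuous g := hT.continuous_eval f x
  have hi (a b : ℝ) : IntervalIntegrable g volume a b := hg.intervalIntegrable a b
  have hb (a b : ℝ) : |∫ s in a..b, g s| ≤ ‖f‖ * |b - a| := by
    rw [← Real.norm_eq_abs]
    exact intervalIntegral.norm_integral_le_of_norm_le_const fun s _ => hT.abs_apply_le _ f x
  have h1 : ∫ s in (0 : ℝ)..N, T s.toNNReal (T t f) x = ∫ s in (t : ℝ)..N + t, g s := by
    rw [← zero_add (t : ℝ), ← add_assoc, add_zero,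
      ← intervalIntegral.integral_comp_add_right g (t : ℝ)]
    refine intervalIntegral.integral_congr fun s hs => ?_
    rw [Set.uIcc_of_le hN.le] at hs
    have hst : (s + t).toNNReal = s.toNNReal + t := by
      rw [Real.toNNReal_add hs.1 t.coe_nonneg, Real.toNNReal_coe]
    simp only [g, hst, hT.add, ContinuousLinearMap.comp_apply]
  have h2 : (∫ s in (t : ℝ)..N + t, g s) - ∫ s in (0 : ℝ)..N, g s =
      (∫ s in N..N + t, g s) - ∫ s in (0 : ℝ)..t, g s := by
    have e1 := intervalIntegral.integral_add_adjacent_intervals (hi 0 t) (hi t (N + t))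
    have e2 := intervalIntegral.integral_add_adjacent_intervals (hi 0 N) (hi N (N + t))
    linarith
  change |N⁻¹ * (∫ s in (0 : ℝ)..N, T s.toNNReal (T t f) x) - N⁻¹ * ∫ s in (0 : ℝ)..N, g s| ≤ _
  rw [h1, ← mul_sub, h2, abs_mul, abs_of_pos (inv_pos.2 hN), mul_comm]
  have e1 := hb N (N + t)
  have e2 := hb 0 t
  rw [add_sub_cancel_left, abs_of_nonneg t.coe_nonneg] at e1
  rw [sub_zero, abs_of_nonneg t.coe_nonneg] at e2
  refine mul_le_mul_of_nonneg_right ((abs_sub _ _).trans ?_) (inv_pos.2 hN).le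
  linarith

/-- **Krylov–Bogoliubov**: a Markov semigroup on `C(X)` has a stationary state. -/
theorem IsMarkovSemigroup.exists_isStationaryState {X : Type*} [MetricSpace X] [CompactSpace X]
    [Nonempty X] [MeasurableSpace X] [BorelSpace X]
    {T : ℝ≥0 → C(X, ℝ) →L[ℝ] C(X, ℝ)} (hT : IsMarkovSemigroup T) :
    ∃ ν : ProbabilityMeasure X, IsStationaryState T ν := by
  obtain ⟨x⟩ := ‹Nonempty X›
  have hN (n : ℕ) : (0 : ℝ) < n + 1 := n.cast_add_one_pos
  have hex (n : ℕ) : ∃ μ : ProbabilityMeasure X, ∀ f : C(X, ℝ),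
      ∫ y, f y ∂(μ : Measure X) = timeAverage hT x (n + 1) f := by
    refine exists_probabilityMeasure_integral_eq _ (fun f hf => ?_) ?_
    · exact mul_nonneg (inv_pos.2 (hN n)).le
        (intervalIntegral.integral_nonneg (hN n).le fun s _ => hT.nonneg _ f hf x)
    · simp [timeAverage, hT.one, (hN n).ne']
  choose μ hμ using hex
  -- Probability measures on a compact metric space form a compact space, so `μ` converges along a
  -- free ultrafilter; no subsequence is needed.
  obtain ⟨ν, -, hν⟩ := isCompact_univ.ultrafilter_le_nhds ((hyperfilter ℕ).map μ) (by simp)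
  have hν : Tendsto μ (hyperfilter ℕ : Filter ℕ) (𝓝 ν) := hν
  have hlim (f : C(X, ℝ)) := ProbabilityMeasure.tendsto_iff_forall_integral_tendsto.1 hν
    (BoundedContinuousFunction.mkOfCompact f)
  simp only [BoundedContinuousFunction.mkOfCompact_apply, hμ] at hlim
  refine ⟨ν, fun t f => ?_⟩
  have h0 : Tendsto (fun n : ℕ => 2 * t * ‖f‖ * ((n : ℝ) + 1)⁻¹)
      (hyperfilter ℕ : Filter ℕ) (𝓝 0) := by
    have := (tendsto_one_div_add_atTop_nhds_zero_nat (𝕜 := ℝ)).const_mul (2 * t * ‖f‖)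
    simp only [one_div, mul_zero] at this
    exact this.mono_left Nat.hyperfilter_le_atTop
  have h1 := squeeze_zero_norm (a := fun n : ℕ => 2 * t * ‖f‖ * ((n : ℝ) + 1)⁻¹)
    (f := fun n : ℕ => timeAverage hT x (n + 1) (T t f) - timeAverage hT x (n + 1) f)
    (fun n => abs_timeAverage_sub_le hT x (hN n) t f) h0
  exact (sub_eq_zero.1 (tendsto_nhds_unique ((hlim (T t f)).sub (hlim f)) h1)).symm

/-- A stationary state annihilates every function `w = L u` in the range of the generator. -/
theorem IsStationaryState.integral_eq_zero [MeasurableSpace X] [BorelSpace X]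
    (hT : IsMarkovSemigroup T) {ν : ProbabilityMeasure X} (hν : IsStationaryState T ν)
    {u w : C(X, ℝ)} (h : T 1 u - u = ∫ s in (0 : ℝ)..1, T s.toNNReal w) :
    ∫ x, w x ∂(ν : Measure X) = 0 := by
  have h1 := congrArg (integralCLM ν) h
  -- Once `ν` is moved inside the time integral, stationarity makes the integrand the constant `∫ w
  -- dν` and cancels the left side.
  rw [← ContinuousLinearMap.intervalIntegral_comp_comm _
    ((hT.continuous_toNNReal w).intervalIntegrable _ _), map_sub] at h1
  simp only [integralCLM_apply, ← hν _ _] at h1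
  simpa using h1.symm

/-- A family of probability measures under which a continuous function with a unique zero `b` has
integral tending to `0` converges weakly to the Dirac measure at `b`. -/
theorem tendsto_diracProba_of_tendsto_integral [MeasurableSpace X] [BorelSpace X]
    {ι : Type*} {l : Filter ι} {ν : ι → ProbabilityMeasure X} {b : X} {u : C(X, ℝ)}
    (hu : ∀ x, x ≠ b → 0 < u x) (hb : u b = 0)
    (h : Tendsto (fun i => ∫ x, u x ∂(ν i : Measure X)) l (𝓝 0)) :
    Tendsto ν l (𝓝 (diracProba b)) := by
  have hu0 (x : X) : 0 ≤ u x := by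
    by_cases hx : x = b
    · rw [hx, hb]
    · exact (hu x hx).le
  refine ProbabilityMeasure.tendsto_iff_forall_integral_tendsto.2 fun g => ?_
  have hdirac : ∫ x, g x ∂(diracProba b : Measure X) = g b :=
    integral_dirac' _ _ g.continuous.stronglyMeasurable
  rw [hdirac, Metric.tendsto_nhds]
  intro ε hε
  -- The compact set `S` where `g` is at least `ε / 2` away from `g b` misses `b`, so `u` is
  -- positive on it and the quotient `|g - g b| / u` is bounded there. Off `S` the term `ε / 2`
  -- suffices.
  obtain ⟨K, hK0, hK⟩ : ∃ K : ℝ, 0 ≤ K ∧ ∀ x, |g x - g b| ≤ ε / 2 + K * u x := by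
    set S : Set X := {x | ε / 2 ≤ |g x - g b|}
    have hS : IsCompact S := (isClosed_le continuous_const (by fun_prop)).isCompact
    have hne (x : X) (hx : x ∈ S) : x ≠ b := by
      rintro rfl
      have : ε / 2 ≤ |g x - g x| := hx
      simp only [sub_self, abs_zero] at this
      linarith
    obtain ⟨K, hK⟩ := hS.exists_bound_of_continuousOn (f := fun x => |g x - g b| / u x)
      (ContinuousOn.div (by fun_prop) (by fun_prop) fun x hx => (hu x (hne x hx)).ne')
    refine ⟨max K 0, le_max_right _ _, fun x => ?_⟩
    by_cases hx : x ∈ S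
    · have h1 := ((le_abs_self _).trans (hK x hx)).trans (le_max_left K 0)
      rw [div_le_iff₀ (hu x (hne x hx))] at h1
      linarith
    · have h1 : |g x - g b| < ε / 2 := not_le.1 hx
      have := mul_nonneg (le_max_right K 0) (hu0 x)
      linarith
  have h2 : Tendsto (fun i => ε / 2 + K * ∫ x, u x ∂(ν i : Measure X)) l (𝓝 (ε / 2)) := by
    simpa using (h.const_mul K).const_add (ε / 2)
  filter_upwards [h2.eventually_lt_const (half_lt_self hε)] with i hi
  refine lt_of_le_of_lt ?_ hi
  have hgi : Integrable g (ν i : Measure X) := g.integrable _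
  have hui := integrable_continuousMap u (ν i : Measure X)
  have e1 : (∫ x, g x ∂(ν i : Measure X)) - g b = ∫ x, (g x - g b) ∂(ν i : Measure X) := by
    rw [integral_sub hgi (integrable_const _)]
    simp
  have e2 : ∫ x, (ε / 2 + K * u x) ∂(ν i : Measure X) =
      ε / 2 + K * ∫ x, u x ∂(ν i : Measure X) := by
    rw [integral_add (integrable_const _) (hui.const_mul K), integral_const_mul]
    simp
  rw [Real.dist_eq, e1, ← e2]
  exact (abs_integral_le_integral_abs).trans (integral_mono
    (hgi.sub (integrable_const _)).abs ((integrable_const _).add (hui.const_mul K)) hK)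

end General

/-! ### The Lyapunov function on the simplex. -/

section Simplex

variable {V : Type*} [Fintype V]

/-- The squared distance to the barycenter of the simplex. -/
noncomputable def sqDist (x : V → ℝ) : ℝ := ∑ i, (x i - (Fintype.card V : ℝ)⁻¹) ^ 2

theorem contDiff_sqDist {n : WithTop ℕ∞} : ContDiff ℝ n (sqDist : (V → ℝ) → ℝ) := by
  unfold sqDist
  fun_prop

/-- Each neighbor sum is at most the total mass `1`, and the weights `x_i` again sum to `1`. -/
theorem sum_mul_neighbor_le_one (G : SimpleGraph V) [DecidableRel G.Adj]
    (x : stdSimplex ℝ V) :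
    ∑ i, x.1 i * ∑ k ∈ G.neighborFinset i, x.1 k ≤ 1 := by
  have h (i : V) : x.1 i * ∑ k ∈ G.neighborFinset i, x.1 k ≤ x.1 i * 1 := by
    refine mul_le_mul_of_nonneg_left ?_ (x.2.1 i)
    rw [← x.2.2]
    exact Finset.sum_le_sum_of_subset_of_nonneg (Finset.subset_univ _) fun k _ _ => x.2.1 k
  simpa [x.2.2] using Finset.sum_le_sum fun i (_ : i ∈ Finset.univ) => h i

theorem sqDist_barycenter [Nonempty V] :
    sqDist (stdSimplex.barycenter : stdSimplex ℝ V).1 = 0 := by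
  simp [sqDist, stdSimplex.barycenter_apply]

theorem sqDist_pos [Nonempty V] {x : stdSimplex ℝ V} (hx : x ≠ stdSimplex.barycenter) :
    0 < sqDist x.1 := by
  refine lt_of_le_of_ne (Finset.sum_nonneg fun i _ => sq_nonneg _) fun h => hx ?_
  refine Subtype.ext (funext fun i => ?_)
  have := (Finset.sum_eq_zero_iff_of_nonneg fun i _ => sq_nonneg _).1 h.symm i (Finset.mem_univ i)
  rw [stdSimplex.barycenter_apply]
  exact sub_eq_zero.1 (pow_eq_zero_iff two_ne_zero |>.1 this)

variable [DecidableEq V]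

theorem partialDeriv_sqDist (i : V) :
    partialDeriv i sqDist = fun x : V → ℝ => 2 * (x i - (Fintype.card V : ℝ)⁻¹) := by
  funext x
  have h : HasFDerivAt (sqDist : (V → ℝ) → ℝ)
      (∑ j, (2 * (x j - (Fintype.card V : ℝ)⁻¹)) • ContinuousLinearMap.proj (R := ℝ) (φ := fun _ : V => ℝ) j) x := by
    refine HasFDerivAt.fun_sum fun j _ => ?_
    simpa using (((ContinuousLinearMap.proj (R := ℝ) (φ := fun _ : V => ℝ) j).hasFDerivAt
      (x := x)).sub_const (Fintype.card V : ℝ)⁻¹).pow 2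
  simp [partialDeriv, h.fderiv, Pi.single_apply]

theorem partialDeriv_partialDeriv_sqDist (i j : V) (x : V → ℝ) :
    partialDeriv i (partialDeriv j sqDist) x = if i = j then 2 else 0 := by
  rw [partialDeriv_sqDist]
  have h : HasFDerivAt (fun x : V → ℝ => 2 * (x j - (Fintype.card V : ℝ)⁻¹))
      ((2 : ℝ) • ContinuousLinearMap.proj (R := ℝ) (φ := fun _ : V => ℝ) j) x :=
    (((ContinuousLinearMap.proj (R := ℝ) (φ := fun _ : V => ℝ) j).hasFDerivAt
      (x := x)).sub_const (Fintype.card V : ℝ)⁻¹).const_mul 2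
  simp [partialDeriv, h.fderiv, Pi.single_apply, eq_comm]

/-- The Hessian of `sqDist` is twice the identity, so only the diagonal of the diffusion matrix
contributes. In the drift, `1 - r x_i = -r (x_i - 1/r)` reproduces `sqDist`. -/
theorem driftOperator_sqDist [Nonempty V] (G : SimpleGraph V) [DecidableRel G.Adj] (α : ℝ)
    (x : V → ℝ) :
    driftOperator G α sqDist x =
      ∑ i, x i * ∑ k ∈ G.neighborFinset i, x k - α * Fintype.card V * sqDist x := by
  have hr : (Fintype.card V : ℝ) ≠ 0 := Nat.cast_ne_zero.2 Fintype.card_ne_zero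
  have h1 (i : V) : ∑ j, diffusionCoeff G x i j * partialDeriv i (partialDeriv j sqDist) x =
      2 * (x i * ∑ k ∈ G.neighborFinset i, x k) := by
    simp_rw [partialDeriv_partialDeriv_sqDist, mul_ite, mul_zero]
    rw [Finset.sum_ite_eq, if_pos (Finset.mem_univ i), diffusionCoeff, if_pos rfl, mul_comm]
  have h2 (i : V) : (1 - (Fintype.card V : ℝ) * x i) * partialDeriv i sqDist x =
      -(2 * Fintype.card V) * (x i - (Fintype.card V : ℝ)⁻¹) ^ 2 := by
    rw [partialDeriv_sqDist]
    field_simp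
    ring
  simp only [driftOperator, h1, h2, ← Finset.mul_sum, ← sqDist.eq_def]
  ring

/-- In a stationary state of the diffusion, the mean squared distance to the barycenter is at most
`1 / (α r)`. -/
theorem IsDiffusionSemigroup.integral_sqDist_le [Nonempty V] {G : SimpleGraph V}
    [DecidableRel G.Adj] {α : ℝ} (hα : 0 < α)
    {T : ℝ≥0 → C(stdSimplex ℝ V, ℝ) →L[ℝ] C(stdSimplex ℝ V, ℝ)}
    (hT : IsDiffusionSemigroup G α T) {ν : ProbabilityMeasure (stdSimplex ℝ V)}
    (hν : IsStationaryState T ν) :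
    ∫ x, onSimplex sqDist (contDiff_sqDist (n := 2)).continuous x ∂(ν : Measure (stdSimplex ℝ V)) ≤
      (α * Fintype.card V)⁻¹ := by
  have hr : (0 : ℝ) < Fintype.card V := Nat.cast_pos.2 Fintype.card_pos
  have h0 := hν.integral_eq_zero hT.markov
    (by simpa using hT.generator sqDist contDiff_sqDist 1)
  set u := onSimplex (V := V) sqDist (contDiff_sqDist (n := 2)).continuous
  have hu := integrable_continuousMap u (ν : Measure (stdSimplex ℝ V))
  have h1 : (0 : ℝ) ≤ ∫ x, (1 - α * Fintype.card V * u x) ∂(ν : Measure (stdSimplex ℝ V)) := by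
    rw [← h0]
    refine integral_mono (integrable_continuousMap _ _)
      ((integrable_const _).sub (hu.const_mul _)) fun x => ?_
    change driftOperator G α sqDist x.1 ≤ 1 - α * Fintype.card V * sqDist x.1
    rw [driftOperator_sqDist]
    exact sub_le_sub_right (sum_mul_neighbor_le_one G x) _
  rw [integral_sub (integrable_const _) (hu.const_mul _), integral_const_mul] at h1
  simp only [integral_const, probReal_univ, smul_eq_mul, one_mul] at h1
  rw [← one_div, le_div_iff₀ (mul_pos hα hr)]
  linarith

end Simplex

end GraphDiffusion

theorem mainTheorem7 {V : Type*} [Fintype V] [DecidableEq V] [Nonempty V]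
    (hr : 2 ≤ Fintype.card V)
    (G : SimpleGraph V) [DecidableRel G.Adj] (hG : G.Connected)
    (T : ℝ → ℝ≥0 → C(stdSimplex ℝ V, ℝ) →L[ℝ] C(stdSimplex ℝ V, ℝ))
    (hT : ∀ α : ℝ, 0 < α → GraphDiffusion.IsDiffusionSemigroup G α (T α)) :
    (∀ α : ℝ, 0 < α → ∃ ν : ProbabilityMeasure (stdSimplex ℝ V),
      GraphDiffusion.IsStationaryState (T α) ν) ∧
    ∀ ν : ℝ → ProbabilityMeasure (stdSimplex ℝ V),
      (∀ α : ℝ, 0 < α → GraphDiffusion.IsStationaryState (T α) (ν α)) →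
      Tendsto ν atTop (𝓝 (diracProba (stdSimplex.barycenter : stdSimplex ℝ V))) := by
  refine ⟨fun α hα => (hT α hα).markov.exists_isStationaryState, fun ν hν => ?_⟩
  refine GraphDiffusion.tendsto_diracProba_of_tendsto_integral
    (u := GraphDiffusion.onSimplex GraphDiffusion.sqDist
      (GraphDiffusion.contDiff_sqDist (n := 2)).continuous)
    (fun x hx => GraphDiffusion.sqDist_pos hx) GraphDiffusion.sqDist_barycenter ?_
  have hr0 : (0 : ℝ) < Fintype.card V := Nat.cast_pos.2 Fintype.card_pos
  refine tendsto_of_tendsto_of_tendsto_of_le_of_le' tendsto_const_nhds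
    (tendsto_inv_atTop_zero.comp (tendsto_id.atTop_mul_const hr0)) ?_ ?_
  · exact Eventually.of_forall fun α =>
      integral_nonneg fun x => Finset.sum_nonneg fun i _ => sq_nonneg _
  -- Stationarity of `ν α` is known only for `α > 0`, so the upper bound holds only eventually.
  · filter_upwards [eventually_gt_atTop 0] with α hα
    exact (hT α hα).integral_sqDist_le hα (hν α hα)
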